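/- Notation. Let $P(\omega)$ be the family of all subsets of $\omega$, with the topology of the Cantor cube $\{0,1\}^\omega$ (sets are identified with their characteristic functions). Let $[\omega]^\omega$, $\mathrm{Fin}$ and $\mathrm{cFin}$ be the families of all infinite, all finite and all cofinite subsets of $\omega$, respectively. An element $a\in[\omega]^\omega$ is also viewed as the function $n\mapsto a(n)$ that enumerates it increasingly. Write $a\subseteq^* b$ if $a\setminus b$ is finite. Let $\mathfrak b$ be the least cardinality of a set $A\subseteq\omega^\omega$ for which there is no $g\in\omega^\omega$ such that, for every $f\in A$, $f(n)\le g(n)$ for all but finitely many $n$. A nonempty family $S\subseteq[\omega]^\omega$ is a semifilter if $a\in S$, $b\in[\omega]^\omega$ and $a\subseteq^* b$ imply $b\in S$; it is meager if it is a meager subset of the space $[\omega]^\omega$. For $a,b\in[\omega]^\omega$ write $a\le_S b$ if $\{n: a(n)\le b(n)\}\in S$. For $x,h\in[\omega]^\omega$ let $x/h=\{n: x\cap[h(n),h(n+1))\ne\emptyset\}$, and $S/h=\{x/h: x\in S\}$. The semifilter trichotomy is the statement that for every semifilter $S$ there is $h\in[\omega]^\omega$ such that $S/h$ is $\mathrm{cFin}$,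 a free ultrafilter on $\omega$, or $[\omega]^\omega$. A set $Z$ is $\mathfrak b$-concentrated on $D\subseteq Z$ if $|Z|\ge\mathfrak b$ and $|Z\setminus U|<\mathfrak b$ for every open set $U\supseteq D$. A space $Z$ is Hurewicz if for every sequence $\mathcal U_0,\mathcal U_1,\dots$ of open covers of $Z$ there are finite sets $\mathcal F_n\subseteq\mathcal U_n$ such that every $x\in Z$ belongs to $\bigcup\mathcal F_n$ for all but finitely many $n$. It is productively Hurewicz if $Z\times Y$ is Hurewicz for every Hurewicz set of reals $Y$, that is, for every infinite Hurewicz space $Y$ homeomorphic to a subspace of $\{0,1\}^\omega$. A set $X\subseteq[\omega]^\omega$ is meager-unbounded if $|X|\ge\mathfrak b$ and for every $b\in[\omega]^\omega$ there are a meager semifilter $S$ and a set $A\subseteq X$ with $|A|<\mathfrak b$ such that $b\le_S x$ for all $x\in X\setminus A$. Theorem. Assume that the semifilter trichotomy holds, and let $X\subseteq[\omega]^\omega$. Then the following statements are equivalent. 1. The set $X\cup\mathrm{Fin}$ is $\mathfrak b$-concentrated on $\mathrm{Fin}$. 2. The set $X\cup\mathrm{Fin}$ is $\mathfrak b$-concentrated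 on $\mathrm{Fin}$ and Hurewicz. 3. The set $X\cup\mathrm{Fin}$ is $\mathfrak b$-concentrated on $\mathrm{Fin}$ and productively Hurewicz. 4. The set $X$ is meager-unbounded. -/

import Mathlib

noncomputable section

namespace SemHur

open Set Filter
open scoped Cardinal

/-- The characteristic function of a set of natural numbers, a point of the Cantor cube. -/
def charFun (a : Set ℕ) : ℕ → Bool := by
  classical exact fun n => decide (n ∈ a)

/-- `P(ω)` carries the topology of the Cantor cube, through characteristic functions. -/
instance powersetTopology : TopologicalSpace (Set ℕ) :=
  TopologicalSpace.induced charFun inferInstance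

theorem charFun_bijective : Function.Bijective charFun := by
  classical
  refine ⟨fun a b h => ?_, fun f => ⟨{n | f n = true}, ?_⟩⟩
  · ext n
    have := congrFun h n
    simpa [charFun] using this
  · funext n
    simp [charFun]

theorem charFun_isEmbedding : Topology.IsEmbedding charFun :=
  ⟨⟨rfl⟩, charFun_bijective.1⟩

/-- `[ω]^ω`: the infinite subsets of `ω`. -/
def infSets : Set (Set ℕ) := {a | a.Infinite}

/-- `Fin`: the finite subsets of `ω`. -/
def finSets : Set (Set ℕ) := {a | a.Finite}

/-- `cFin`: the Fréchet filter of cofinite subsets of `ω`. -/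
def cofinSets : Set (Set ℕ) := {a | aᶜ.Finite}

/-- The increasing enumeration of (an infinite set) `a`. -/
def enum (a : Set ℕ) : ℕ → ℕ := Nat.nth (fun n => n ∈ a)

/-- Almost inclusion `a ⊆* b`. -/
def AlmostSubset (a b : Set ℕ) : Prop := (a \ b).Finite

/-- A semifilter: a nonempty family of infinite subsets of `ω` that is closed under taking
infinite almost supersets. -/
structure IsSemifilter (S : Set (Set ℕ)) : Prop where
  subset : S ⊆ infSets
  nonempty : S.Nonempty
  upward : ∀ a ∈ S, ∀ b ∈ infSets, AlmostSubset a b → b ∈ S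

/-- A family of infinite sets is meager if it is a meager subset of the space `[ω]^ω`. -/
def IsMeagerFamily (S : Set (Set ℕ)) : Prop :=
  IsMeagre (Subtype.val ⁻¹' S : Set ↥infSets)

/-- `a ≤_S b`: the set of all `n` with `a(n) ≤ b(n)` belongs to `S`. -/
def LeMod (S : Set (Set ℕ)) (a b : Set ℕ) : Prop := {n | enum a n ≤ enum b n} ∈ S

/-- `x / h`: the set of all `n` such that `x` meets the interval `[h(n), h(n+1))`. -/
def setQuot (x h : Set ℕ) : Set ℕ := {n | (x ∩ Ico (enum h n) (enum h (n + 1))).Nonempty}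

/-- `S / h`. -/
def familyQuot (S : Set (Set ℕ)) (h : Set ℕ) : Set (Set ℕ) := (fun x => setQuot x h) '' S

/-- The family `S` is a free ultrafilter on `ω`. -/
def IsFreeUltrafilter (S : Set (Set ℕ)) : Prop :=
  ∃ U : Ultrafilter ℕ, (∀ a ∈ U, a.Infinite) ∧ S = {a | a ∈ U}

/-- The semifilter trichotomy. -/
def SemifilterTrichotomy : Prop :=
  ∀ S : Set (Set ℕ), IsSemifilter S → ∃ h ∈ infSets,
    familyQuot S h = cofinSets ∨ IsFreeUltrafilter (familyQuot S h) ∨ familyQuot S h = infSets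

/-- A set of functions is bounded if one function eventually dominates all its elements. -/
def IsBoundedFamily (A : Set (ℕ → ℕ)) : Prop :=
  ∃ b : ℕ → ℕ, ∀ a ∈ A, ∀ᶠ n in atTop, a n ≤ b n

/-- The cardinal `𝔟`: the minimal cardinality of an unbounded subset of `ω^ω`. -/
def cardB : Cardinal.{0} := sInf {κ | ∃ A : Set (ℕ → ℕ), ¬ IsBoundedFamily A ∧ #A = κ}

/-- The set `X` is `κ`-concentrated on `D ⊆ X`. -/
structure IsConcentratedOn {α : Type} [TopologicalSpace α] (κ : Cardinal.{0}) (X D : Set α) :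
    Prop where
  subset : D ⊆ X
  card_le : κ ≤ #X
  card_diff_lt : ∀ U : Set α, IsOpen U → D ⊆ U → #(X \ U : Set α) < κ

/-- The Hurewicz covering property. -/
def IsHurewicz (α : Type) [TopologicalSpace α] : Prop :=
  ∀ U : ℕ → Set (Set α), (∀ n, (∀ V ∈ U n, IsOpen V) ∧ ⋃₀ U n = univ) →
    ∃ F : ℕ → Set (Set α), (∀ n, F n ⊆ U n ∧ (F n).Finite) ∧
      ∀ x : α, ∀ᶠ n in atTop, x ∈ ⋃₀ F n

/-- A set of reals: an infinite space that is homeomorphic to a subspace of the Cantor cube. -/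
structure IsSetOfReals (α : Type) [TopologicalSpace α] : Prop where
  infinite : Infinite α
  embeds : ∃ f : α → ℕ → Bool, Topology.IsEmbedding f

/-- The product with every Hurewicz set of reals is Hurewicz. -/
def IsProductivelyHurewicz (α : Type) [TopologicalSpace α] : Prop :=
  ∀ (β : Type) [TopologicalSpace β], IsSetOfReals β → IsHurewicz β → IsHurewicz (α × β)

/-- Meager-unbounded subsets of `[ω]^ω`. -/
def IsMeagerUnbounded (X : Set (Set ℕ)) : Prop :=
  cardB ≤ #X ∧ ∀ b ∈ infSets, ∃ S : Set (Set ℕ), IsSemifilter S ∧ IsMeagerFamily S ∧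
    ∃ A ⊆ X, #A < cardB ∧ ∀ x ∈ X \ A, LeMod S b x

end SemHur

end

/-!
For `x ∈ X` and `f : ℕ → ℕ` let `c x = {n | f n ≤ x(n)}`. If `X` has at least `𝔟` elements, all four
properties are equivalent to the condition `IsIntervalUnbounded`: for every `f` there is one
interval partition such that, for all but fewer than `𝔟` many `x ∈ X`, the set `c x` meets almost
all intervals of the partition.

*From concentration to `IsIntervalUnbounded`* (`IsConcentratedOn.isIntervalUnbounded`). This is the
only use of the semifilter trichotomy. Sets of the form `{x | ∀ n, x(n) ≤ f n}` are disjoint from an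
open set containing `Fin`. Hence concentration says that such a set contains fewer than `𝔟` many `x
∈ X`, and this yields, for each infinite `a`, that `c x ∩ a` is infinite for all but fewer than `𝔟`
many `x` (`card_finite_inter_lt`). Discard those `x` for which `c x` is finite, and let `S` be the
semifilter generated by the remaining sets `c x`. If `S / h` is `cFin`, then `h` is the required
partition. If `S / h` is a free ultrafilter or `[ω]^ω`, then it is partition regular: whenever an
element is cut into two parts, one of them is again an element. Cutting along the even numbers gives
an element `u` with infinite complement. The sets `c x / h` almost contained in `u` are almost
disjoint from the complement of `u`, so there are fewer than `𝔟` of them, and one set splits them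
all (`exists_splitting`). Cutting `u` along that set gives a contradiction
(`not_isPartitionRegular_familyQuot`).

*From `IsIntervalUnbounded` to the other properties.* The infinite sets meeting almost all intervals
of a partition form a meager semifilter, which gives meager-unboundedness. For the productive
Hurewicz property (`IsIntervalUnbounded.isProductivelyHurewicz`), take increasing open covers of `(X
∪ Fin) × Y`. Compactness of `P([0, k))` and the Hurewicz property of `Y` provide a function `g` such
that, for every `y ∈ Y` and almost all `k`, the points `(x, y)` with `x ∩ [k, g(k)) = ∅` are covered
at stage `g(k)` (`exists_gap_bound`). If `x(j)` is large compared with iterates of `g`, then `x` has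
few elements below `x(j)` and so has such a gap (`exists_gap`). The fewer than `𝔟` many exceptional
`x` are handled one by one, with bounds that are dominated by a single function.

*From meager-unboundedness to concentration* (`IsMeagerUnbounded.isConcentratedOn`). The complement
of an open set containing `Fin` is a family of infinite sets with enumerations bounded by a single
function, so it can only contain the exceptional elements of `X` for that function.
-/

open Set Filter Topology
open scoped Cardinal

namespace SemHur

/-! ### The cardinal `𝔟` -/

lemma isBoundedFamily_of_card_lt {A : Set (ℕ → ℕ)} (h : #A < cardB) : IsBoundedFamily A := by
  by_contra hA
  exact (csInf_le' ⟨A, hA, rfl⟩ : cardB ≤ #A).not_gt h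

lemma exists_bound_of_card_lt {α : Type} {A : Set α} (h : #A < cardB) (f : α → ℕ → ℕ) :
    ∃ g : ℕ → ℕ, ∀ a ∈ A, ∀ᶠ n in atTop, f a n ≤ g n := by
  obtain ⟨g, hg⟩ := isBoundedFamily_of_card_lt (Cardinal.mk_image_le.trans_lt h : #(f '' A) < cardB)
  exact ⟨g, fun a ha => hg _ (mem_image_of_mem f ha)⟩

lemma IsBoundedFamily.iUnion {A : ℕ → Set (ℕ → ℕ)} (h : ∀ n, IsBoundedFamily (A n)) :
    IsBoundedFamily (⋃ n, A n) := by
  choose g hg using h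
  refine ⟨fun n => (Finset.range (n + 1)).sup fun i => g i n, fun a ha => ?_⟩
  obtain ⟨i, hi⟩ := mem_iUnion.1 ha
  filter_upwards [hg i a hi, eventually_ge_atTop i] with n h1 h2
  exact h1.trans (Finset.le_sup (f := fun i => g i n) (Finset.mem_range.2 (by omega)))

lemma exists_not_isBoundedFamily : ∃ A : Set (ℕ → ℕ), ¬ IsBoundedFamily A ∧ #A = cardB := by
  refine csInf_mem (s := {κ | ∃ A : Set (ℕ → ℕ), ¬ IsBoundedFamily A ∧ #A = κ})
    ⟨_, univ, ?_, rfl⟩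
  rintro ⟨b, hb⟩
  obtain ⟨n, hn⟩ := (hb (fun n => b n + 1) (mem_univ _)).exists
  omega

/-- `𝔟` has uncountable cofinality: an unbounded family of size `𝔟` is not a countable union of
smaller (hence bounded) families. -/
lemma card_iUnion_lt {α : Type} {A : ℕ → Set α} (h : ∀ n, #(A n) < cardB) :
    #(⋃ n, A n : Set α) < cardB := by
  by_contra! hc
  obtain ⟨B, hB, hBc⟩ := exists_not_isBoundedFamily
  rw [← hBc] at hc
  obtain ⟨e⟩ := hc
  apply hB
  have hU : B = ⋃ n, {b | ∃ hb : b ∈ B, (e ⟨b, hb⟩ : α) ∈ A n} := by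
    ext b
    simp only [mem_iUnion, mem_ofPred_eq]
    exact ⟨fun hb => (mem_iUnion.1 (e ⟨b, hb⟩).2).imp fun n hn => ⟨hb, hn⟩, fun ⟨_, hb, _⟩ => hb⟩
  rw [hU]
  refine IsBoundedFamily.iUnion fun n => isBoundedFamily_of_card_lt (lt_of_le_of_lt ?_ (h n))
  refine Cardinal.mk_le_of_injective
    (f := fun b : {b | ∃ hb : b ∈ B, (e ⟨b, hb⟩ : α) ∈ A n} =>
      (⟨e ⟨b.1, b.2.choose⟩, b.2.choose_spec⟩ : A n)) fun b c hbc => ?_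
  have h1 := e.injective (Subtype.ext (Subtype.mk.inj hbc))
  exact Subtype.ext (Subtype.mk.inj h1)

lemma aleph0_lt_cardB : ℵ₀ < cardB := by
  obtain ⟨B, hB, hBc⟩ := exists_not_isBoundedFamily
  rw [← hBc]
  by_contra! hc
  have hcount : B.Countable := Cardinal.le_aleph0_iff_set_countable.1 hc
  obtain rfl | hne := B.eq_empty_or_nonempty
  · exact hB ⟨0, by simp⟩
  · obtain ⟨f, rfl⟩ := hcount.exists_eq_range hne
    apply hB
    rw [← iUnion_singleton_eq_range]
    refine IsBoundedFamily.iUnion fun n => ⟨f n, ?_⟩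
    rintro a rfl
    exact Eventually.of_forall fun _ => le_rfl

lemma card_union_lt {α : Type} {A B : Set α} (hA : #A < cardB) (hB : #B < cardB) :
    #(A ∪ B : Set α) < cardB :=
  (Cardinal.mk_union_le A B).trans_lt (Cardinal.add_lt_of_lt aleph0_lt_cardB.le hA hB)

/-- Adding the countable family of finite sets does not affect whether the cardinality is at
least `𝔟`. -/
lemma cardB_le_union_finSets_iff {X : Set (Set ℕ)} :
    cardB ≤ #(X ∪ finSets : Set (Set ℕ)) ↔ cardB ≤ #X := by
  refine ⟨fun h => ?_, fun h => h.trans (Cardinal.mk_le_mk_of_subset subset_union_left)⟩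
  by_contra! hX
  have hfin : #finSets < cardB :=
    (Cardinal.le_aleph0_iff_set_countable.2 Countable.ofPred_finite).trans_lt aleph0_lt_cardB
  exact (card_union_lt hX hfin).not_ge h

/-! ### Enumerations and interval partitions -/

lemma enum_strictMono {a : Set ℕ} (ha : a.Infinite) : StrictMono (enum a) :=
  Nat.nth_strictMono ha

lemma enum_mem {a : Set ℕ} (ha : a.Infinite) (n : ℕ) : enum a n ∈ a :=
  Nat.nth_mem_of_infinite ha n

lemma range_enum {a : Set ℕ} (ha : a.Infinite) : range (enum a) = a :=
  Nat.range_nth_of_infinite ha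

lemma enum_range {f : ℕ → ℕ} (hf : StrictMono f) : enum (range f) = f :=
  ((enum_strictMono (infinite_range_of_injective hf.injective)).range_inj hf).1
    (range_enum (infinite_range_of_injective hf.injective))

lemma exists_strictMono_le (g : ℕ → ℕ) : ∃ d : ℕ → ℕ, StrictMono d ∧ ∀ i, g (d i) ≤ d (i + 1) := by
  refine ⟨fun i => Nat.rec 0 (fun _ m => max (m + 1) (g m)) i, ?_, fun i => le_max_right _ _⟩
  exact strictMono_nat_of_lt_succ fun i => Nat.lt_of_succ_le (le_max_left _ _)

lemma exists_mem_Ico_of_strictMono {h : ℕ → ℕ} (hh : StrictMono h) {m : ℕ} (hm : h 0 ≤ m) :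
    ∃ n, m ∈ Ico (h n) (h (n + 1)) := by
  have hex : ∃ n, m < h (n + 1) := ⟨m, (Nat.lt_succ_self m).trans_le (hh.le_apply)⟩
  classical
  refine ⟨Nat.find hex, ?_, Nat.find_spec hex⟩
  rcases h0 : Nat.find hex with _ | k
  · exact hm
  · exact not_lt.1 (Nat.find_min hex (m := k) (by omega))

/-- If an infinite set meets consecutive intervals `[d(i), d(i+1))`, then its enumeration is
bounded accordingly. -/
lemma enum_lt_of_meets {x : Set ℕ} (hx : x.Infinite) {d : ℕ → ℕ} {n j : ℕ}
    (h : ∀ i, n ≤ i → i ≤ n + j → (x ∩ Ico (d i) (d (i + 1))).Nonempty) :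
    enum x j < d (n + j + 1) := by
  induction j with
  | zero =>
    obtain ⟨p, hpx, -, hp⟩ := h n le_rfl le_rfl
    obtain ⟨r, rfl⟩ := (range_enum hx).symm ▸ hpx
    exact ((enum_strictMono hx).monotone (Nat.zero_le r)).trans_lt hp
  | succ j ih =>
    obtain ⟨p, hpx, hp', hp⟩ := h (n + (j + 1)) (by omega) le_rfl
    obtain ⟨r, rfl⟩ := (range_enum hx).symm ▸ hpx
    have h1 := (ih fun i hi hi' => h i hi (by omega)).trans_le hp'
    have h2 : j < r := (enum_strictMono hx).lt_iff_lt.1 h1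
    exact ((enum_strictMono hx).monotone h2).trans_lt hp

/-- Fewer than `𝔟` infinite sets are all eventually met by the intervals of one partition. -/
lemma exists_partition_meets {Z : Set (Set ℕ)} (hZ : #Z < cardB) (hinf : ∀ z ∈ Z, z.Infinite) :
    ∃ d : ℕ → ℕ, StrictMono d ∧
      ∀ z ∈ Z, ∀ᶠ i in atTop, (z ∩ Ico (d i) (d (i + 1))).Nonempty := by
  have hnext : ∀ z : Set ℕ, ∃ f : ℕ → ℕ, z ∈ Z → ∀ n, f n ∈ z ∧ n < f n := fun z => by
    by_cases hz : z ∈ Z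
    · choose f hf using (hinf z hz).exists_gt
      exact ⟨f, fun _ => hf⟩
    · exact ⟨0, fun h => absurd h hz⟩
  choose f hf using hnext
  obtain ⟨g, hg⟩ := exists_bound_of_card_lt hZ f
  obtain ⟨d, hd, hgd⟩ := exists_strictMono_le fun n => g n + 1
  refine ⟨d, hd, fun z hz => ?_⟩
  filter_upwards [hd.tendsto_atTop.eventually (hg z hz)] with i hi
  exact ⟨f z (d i), (hf z hz _).1, (hf z hz _).2.le, by have := hgd i; omega⟩

/-- Fewer than `𝔟` infinite sets are split by a single set: take the union of every second interval
of a partition all of whose intervals, up to finitely many, are met. -/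
lemma exists_splitting {Z : Set (Set ℕ)} (hZ : #Z < cardB) (hinf : ∀ z ∈ Z, z.Infinite) :
    ∃ a : Set ℕ, ∀ z ∈ Z, (z ∩ a).Infinite ∧ (z \ a).Infinite := by
  obtain ⟨d, hd, hmeet⟩ := exists_partition_meets hZ hinf
  refine ⟨⋃ i, Ico (d (2 * i)) (d (2 * i + 1)), fun z hz => ?_⟩
  obtain ⟨N, hN⟩ := eventually_atTop.1 (hmeet z hz)
  constructor
  · refine infinite_of_forall_exists_gt fun m => ?_
    obtain ⟨p, hpz, hp⟩ := hN (2 * (N + m + 1)) (by omega)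
    have := hd.le_apply (x := 2 * (N + m + 1))
    exact ⟨p, ⟨hpz, mem_iUnion.2 ⟨_, hp⟩⟩, by have := hp.1; omega⟩
  · refine infinite_of_forall_exists_gt fun m => ?_
    obtain ⟨p, hpz, hp⟩ := hN (2 * (N + m + 1) + 1) (by omega)
    have := hd.le_apply (x := 2 * (N + m + 1) + 1)
    refine ⟨p, ⟨hpz, fun hpa => ?_⟩, by have := hp.1; omega⟩
    obtain ⟨i, hi⟩ := mem_iUnion.1 hpa
    have h1 := hd.lt_iff_lt.1 (hp.1.trans_lt hi.2)
    have h2 := hd.lt_iff_lt.1 (hi.1.trans_lt hp.2)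
    omega

/-! ### The topology of `P(ω)` -/

lemma isClopen_mem (i : ℕ) : IsClopen {z : Set ℕ | i ∈ z} := by
  have : {z : Set ℕ | i ∈ z} = charFun ⁻¹' ((fun f : ℕ → Bool => f i) ⁻¹' {true}) := by
    ext z; simp [charFun]
  rw [this]
  exact ((isClopen_discrete _).preimage (continuous_apply i)).preimage charFun_isEmbedding.continuous

lemma isClopen_meets_Ico (k l : ℕ) : IsClopen {z : Set ℕ | (z ∩ Ico k l).Nonempty} := by
  have : {z : Set ℕ | (z ∩ Ico k l).Nonempty} = ⋃ i ∈ Ico k l, {z : Set ℕ | i ∈ z} := by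
    ext z
    simp only [mem_ofPred_eq, mem_iUnion, Set.Nonempty, mem_inter_iff]
    exact exists_congr fun i => by rw [and_comm, exists_prop]
  rw [this]
  exact (finite_Ico k l).isClopen_biUnion fun i _ => isClopen_mem i

lemma exists_cylinder_subset {U : Set (Set ℕ)} (hU : IsOpen U) {a : Set ℕ} (ha : a ∈ U) :
    ∃ l, ∀ z : Set ℕ, (∀ i < l, (i ∈ z ↔ i ∈ a)) → z ∈ U := by
  obtain ⟨V, hV, rfl⟩ := charFun_isEmbedding.isOpen_iff.1 hU
  obtain ⟨I, u, hu, hIV⟩ := isOpen_pi_iff.1 hV _ ha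
  refine ⟨I.sup id + 1, fun z hz => hIV fun i hi => ?_⟩
  have h1 : i ≤ I.sup id := Finset.le_sup (f := id) hi
  have : charFun z i = charFun a i := by simp [charFun, hz i (by omega)]
  rw [this]
  exact (hu i hi).2

instance : SecondCountableTopology (Set ℕ) :=
  charFun_isEmbedding.secondCountableTopology

/-! ### Meager semifilters given by interval partitions -/

/-- The infinite sets that eventually meet the intervals `[h(n), h(n+1))` form a meager
semifilter. -/
def meetSemifilter (h : ℕ → ℕ) : Set (Set ℕ) :=
  {a | a.Infinite ∧ ∀ᶠ n in atTop, (a ∩ Ico (h n) (h (n + 1))).Nonempty}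

lemma isSemifilter_meetSemifilter {h : ℕ → ℕ} (hh : StrictMono h) :
    IsSemifilter (meetSemifilter h) where
  subset _ ha := ha.1
  nonempty := ⟨univ, infinite_univ, Eventually.of_forall fun n =>
    ⟨h n, mem_univ _, le_rfl, hh n.lt_succ_self⟩⟩
  upward a ha b hb hab := by
    refine ⟨hb, ?_⟩
    obtain ⟨M, hM⟩ := hab.bddAbove
    filter_upwards [ha.2, eventually_gt_atTop M] with n hn hMn
    obtain ⟨p, hpa, hp⟩ := hn
    refine ⟨p, ?_, hp⟩
    by_contra hpb
    have h1 := hM ⟨hpa, hpb⟩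
    have h2 := hh.le_apply (x := n)
    have h3 := hp.1
    omega

lemma isMeagerFamily_meetSemifilter {h : ℕ → ℕ} (hh : StrictMono h) :
    IsMeagerFamily (meetSemifilter h) := by
  let F : ℕ → Set ↥infSets := fun N => {a | ∀ n ≥ N, (a.1 ∩ Ico (h n) (h (n + 1))).Nonempty}
  have hsub : (Subtype.val ⁻¹' meetSemifilter h : Set ↥infSets) ⊆ ⋃ N, F N := fun a ha =>
    mem_iUnion.2 (eventually_atTop.1 ha.2)
  refine (isMeagre_iUnion fun N => IsNowhereDense.isMeagre ?_).mono hsub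
  have hclosed : IsClosed (F N) := by
    have : F N = ⋂ n ≥ N, Subtype.val ⁻¹' {z : Set ℕ | (z ∩ Ico (h n) (h (n + 1))).Nonempty} := by
      ext a
      simp [F]
    rw [this]
    exact isClosed_biInter fun n _ =>
      (isClopen_meets_Ico _ _).isClosed.preimage continuous_subtype_val
  rw [hclosed.isNowhereDense_iff, eq_empty_iff_forall_notMem]
  rintro a ha
  obtain ⟨V, hV, hVF⟩ := isOpen_induced_iff.1 (isOpen_interior (s := F N))
  have haV : a.1 ∈ V := by rw [← hVF] at ha; exact ha
  obtain ⟨l, hl⟩ := exists_cylinder_subset hV haV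
  -- Keep `a` below `l` and skip the whole interval with index `max l N`.
  let b : Set ℕ := (a.1 ∩ Iio l) ∪ Ici (h (max l N + 1))
  have hge : max l N ≤ h (max l N) := hh.le_apply
  have hlt : h (max l N) < h (max l N + 1) := hh (Nat.lt_succ_self _)
  have hb : b ∈ infSets := (Ici_infinite _).mono subset_union_right
  have hbV : b ∈ V := hl b fun i hi => by
    simp only [b, mem_union, mem_inter_iff, mem_Iio, mem_Ici]
    have : l ≤ max l N := le_max_left _ _
    constructor
    · rintro (h1 | h1)
      · exact h1.1
      · omega
    · exact fun h1 => Or.inl ⟨h1, hi⟩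
  have hbF : (⟨b, hb⟩ : ↥infSets) ∈ F N := interior_subset (hVF ▸ hbV)
  obtain ⟨p, hp1, hp2⟩ := hbF (max l N) (le_max_right _ _)
  have : l ≤ max l N := le_max_left _ _
  rcases hp1 with h1 | h1
  · have := h1.2; have := hp2.1; simp only [mem_Iio] at *; omega
  · exact absurd hp2.2 (not_lt.2 h1)

/-! ### The Hurewicz property -/

/-- The Hurewicz property for increasing open covers indexed by `ℕ`; finite subfamilies are then
replaced by single members. -/
lemma IsHurewicz.exists_bound {α : Type} [TopologicalSpace α] (hα : IsHurewicz α)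
    {U : ℕ → ℕ → Set α} (hmono : ∀ n, Monotone (U n)) (hopen : ∀ n m, IsOpen (U n m))
    (hcov : ∀ n x, ∃ m, x ∈ U n m) : ∃ g : ℕ → ℕ, ∀ x, ∀ᶠ n in atTop, x ∈ U n (g n) := by
  obtain ⟨F, hF, hFx⟩ := hα (fun n => range (U n)) fun n =>
    ⟨forall_mem_range.2 (hopen n), by simpa [sUnion_range, eq_univ_iff_forall] using hcov n⟩
  have hg : ∀ n, ∃ m, ∀ V ∈ F n, V ⊆ U n m := fun n => by
    have hidx : ∀ V : Set α, ∃ m, V ∈ F n → V ⊆ U n m := fun V => by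
      by_cases hV : V ∈ F n
      · obtain ⟨m, rfl⟩ := (hF n).1 hV
        exact ⟨m, fun _ => Subset.rfl⟩
      · exact ⟨0, fun h => absurd h hV⟩
    choose idx hidx using hidx
    obtain ⟨m, hm⟩ := ((hF n).2.image idx).bddAbove
    exact ⟨m, fun V hV => (hidx V hV).trans (hmono n (hm (mem_image_of_mem _ hV)))⟩
  choose g hg using hg
  exact ⟨g, fun x => (hFx x).mono fun n ⟨V, hV, hx⟩ => hg n V hV hx⟩

/-- In a second countable space, increasing countable covers suffice to test the Hurewicz
property. -/
lemma isHurewicz_of_exists_bound {α : Type} [TopologicalSpace α] [SecondCountableTopology α]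
    (h : ∀ U : ℕ → ℕ → Set α, (∀ n, Monotone (U n)) → (∀ n m, IsOpen (U n m)) →
      (∀ n x, ∃ m, x ∈ U n m) → ∃ g : ℕ → ℕ, ∀ x, ∀ᶠ n in atTop, x ∈ U n (g n)) :
    IsHurewicz α := by
  intro U hU
  rcases isEmpty_or_nonempty α with _ | ⟨⟨x₀⟩⟩
  · exact ⟨fun _ => ∅, by simp, isEmptyElim⟩
  have hV : ∀ n, ∃ V : ℕ → Set α, (∀ i, V i ∈ U n) ∧ ⋃ i, V i = univ := fun n => by
    obtain ⟨T, hT, hTU, hTs⟩ := TopologicalSpace.isOpen_sUnion_countable (U n) (hU n).1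
    rw [(hU n).2] at hTs
    have hne : T.Nonempty := by
      obtain ⟨V, hV, -⟩ : x₀ ∈ ⋃₀ T := hTs ▸ mem_univ x₀
      exact ⟨V, hV⟩
    obtain ⟨V, rfl⟩ := hT.exists_eq_range hne
    exact ⟨V, fun i => hTU (mem_range_self i), by rwa [sUnion_range] at hTs⟩
  choose V hVU hVcov using hV
  obtain ⟨g, hg⟩ := h (fun n m => ⋃ i ≤ m, V n i)
    (fun n m m' hm => biUnion_subset_biUnion_left fun i (hi : i ≤ m) => hi.trans hm)
    (fun n m => isOpen_biUnion fun i _ => (hU n).1 _ (hVU n i))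
    (fun n x => by
      obtain ⟨i, hi⟩ := mem_iUnion.1 ((hVcov n).symm ▸ mem_univ x)
      exact ⟨i, mem_biUnion (le_refl i) hi⟩)
  refine ⟨fun n => V n '' Iic (g n), fun n => ⟨?_, (finite_Iic _).image _⟩, fun x => ?_⟩
  · rintro _ ⟨i, -, rfl⟩
    exact hVU n i
  · filter_upwards [hg x] with n hn
    obtain ⟨i, hi, hx⟩ := mem_iUnion₂.1 hn
    exact ⟨_, mem_image_of_mem _ hi, hx⟩

lemma isHurewicz_of_compactSpace (α : Type) [TopologicalSpace α] [SecondCountableTopology α]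
    [CompactSpace α] : IsHurewicz α := by
  refine isHurewicz_of_exists_bound fun U hmono hopen hcov => ?_
  have : ∀ n, ∃ m, univ ⊆ U n m := fun n =>
    isCompact_univ.elim_directed_cover (U n) (hopen n)
      (fun x _ => mem_iUnion.2 (hcov n x)) (hmono n).directed_le
  choose g hg using this
  exact ⟨g, fun x => Eventually.of_forall fun n => hg n (mem_univ x)⟩

lemma isSetOfReals_cantor : IsSetOfReals (ℕ → Bool) where
  infinite := inferInstance
  embeds := ⟨id, .id⟩

/-- The Hurewicz property passes to a factor of a product with the Cantor cube. -/
lemma IsProductivelyHurewicz.isHurewicz {α : Type} [TopologicalSpace α]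
    [SecondCountableTopology α] (h : IsProductivelyHurewicz α) : IsHurewicz α := by
  refine isHurewicz_of_exists_bound fun U hmono hopen hcov => ?_
  obtain ⟨g, hg⟩ := (h _ isSetOfReals_cantor (isHurewicz_of_compactSpace _)).exists_bound
    (U := fun n m => Prod.fst ⁻¹' U n m) (fun n _ _ hm => preimage_mono (hmono n hm))
    (fun n m => (hopen n m).preimage continuous_fst) (fun n x => hcov n x.1)
  exact ⟨g, fun x => hg (x, fun _ => false)⟩

/-! ### Unboundedness and concentration -/

/-- A uniform form of meager-unboundedness: for every `f`, some interval partition has the property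
that all but fewer than `𝔟` many `x ∈ X` satisfy `f(k) ≤ x(k)` for some `k` in each of almost all of
its intervals. -/
def IsIntervalUnbounded (X : Set (Set ℕ)) : Prop :=
  ∀ f : ℕ → ℕ, ∃ h : ℕ → ℕ, StrictMono h ∧ ∃ A ⊆ X, #A < cardB ∧
    ∀ x ∈ X \ A, ∀ᶠ n in atTop, ∃ k ∈ Ico (h n) (h (n + 1)), f k ≤ enum x k

lemma IsIntervalUnbounded.isMeagerUnbounded {X : Set (Set ℕ)} (hX : IsIntervalUnbounded X)
    (hcard : cardB ≤ #X) : IsMeagerUnbounded X := by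
  refine ⟨hcard, fun b _ => ?_⟩
  obtain ⟨h, hh, A, hA, hAc, hmeet⟩ := hX (enum b)
  refine ⟨meetSemifilter h, isSemifilter_meetSemifilter hh, isMeagerFamily_meetSemifilter hh,
    A, hA, hAc, fun x hx => ?_⟩
  have hev := hmeet x hx
  obtain ⟨N, hN⟩ := eventually_atTop.1 hev
  refine ⟨infinite_of_forall_exists_gt fun m => ?_, hev.mono fun n ⟨k, hk, hle⟩ => ⟨k, hle, hk⟩⟩
  obtain ⟨k, hk, hle⟩ := hN (N + m + 1) (by omega)
  have := hh.le_apply (x := N + m + 1)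
  exact ⟨k, hle, by have := hk.1; omega⟩

/-- An open set containing `Fin` has a complement consisting of infinite sets whose enumerations
are bounded by a single function. -/
lemma exists_enum_lt_of_notMem {U : Set (Set ℕ)} (hU : IsOpen U) (hfin : finSets ⊆ U) :
    ∃ f : ℕ → ℕ, StrictMono f ∧ ∀ x : Set ℕ, x ∉ U → ∀ n, enum x n < f n := by
  have htube : ∀ k, ∃ l, ∀ z : Set ℕ, z ∩ Ico k l = ∅ → z ∈ U := fun k => by
    have hev : ∀ᶠ l in atTop, ∀ s ∈ 𝒫 (Iio k), ∀ z : Set ℕ, (∀ i < l, (i ∈ z ↔ i ∈ s)) → z ∈ U := by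
      refine (eventually_all_finite (finite_Iio k).finite_subsets).2 fun s hs => ?_
      obtain ⟨l, hl⟩ := exists_cylinder_subset hU (hfin ((finite_Iio k).subset hs))
      exact (eventually_ge_atTop l).mono fun l' hl' z hz => hl z fun i hi => hz i (hi.trans_le hl')
    obtain ⟨l, hl⟩ := hev.exists
    refine ⟨l, fun z hz => hl (z ∩ Iio k) inter_subset_right z fun i hi => ?_⟩
    refine ⟨fun hiz => ⟨hiz, ?_⟩, fun h => h.1⟩
    by_contra hik
    exact hz.subset ⟨hiz, not_lt.1 hik, hi⟩
  choose l hl using htube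
  obtain ⟨d, hd, hld⟩ := exists_strictMono_le l
  refine ⟨fun n => d (n + 1), fun m n hmn => hd (by omega), fun x hx n => ?_⟩
  have hinf : x.Infinite := fun hx' => hx (hfin hx')
  have := enum_lt_of_meets hinf (d := d) (n := 0) (j := n) fun i _ _ => by
    by_contra hne
    refine hx (hl (d i) x (subset_eq_empty ?_ (not_nonempty_iff_eq_empty.1 hne)))
    exact inter_subset_inter_right _ (Ico_subset_Ico_right (hld i))
  simpa using this

lemma IsMeagerUnbounded.isConcentratedOn {X : Set (Set ℕ)} (hX : IsMeagerUnbounded X) :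
    IsConcentratedOn cardB (X ∪ finSets) finSets where
  subset := subset_union_right
  card_le := cardB_le_union_finSets_iff.2 hX.1
  card_diff_lt U hU hfin := by
    obtain ⟨f, hf, hlt⟩ := exists_enum_lt_of_notMem hU hfin
    obtain ⟨S, hS, -, A, -, hAc, hA⟩ := hX.2 (range f) (infinite_range_of_injective hf.injective)
    refine (Cardinal.mk_le_mk_of_subset ?_).trans_lt hAc
    rintro x ⟨hx | hx, hxU⟩
    · by_contra hxA
      obtain ⟨n, hn⟩ := (hS.subset (hA x ⟨hx, hxA⟩)).nonempty
      rw [mem_ofPred_eq, enum_range hf] at hn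
      exact (hlt x hxU n).not_ge hn
    · exact absurd (hfin hx) hxU

lemma card_dominated_lt {X : Set (Set ℕ)} (hX : X ⊆ infSets)
    (h : IsConcentratedOn cardB (X ∪ finSets) finSets) (c : ℕ → ℕ) :
    #{x ∈ X | ∀ n, enum x n ≤ c n} < cardB := by
  obtain ⟨d, hd, hcd⟩ := exists_strictMono_le fun n => c n + 1
  -- If `x(n) ≤ c(n)` for all `n`, then `d(i) ≤ x(d(i)) ≤ c(d(i)) < d(i+1)`.
  let U : Set (Set ℕ) := ⋃ i, {z | (z ∩ Ico (d i) (d (i + 1))).Nonempty}ᶜ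
  have hU : IsOpen U := isOpen_iUnion fun i => (isClopen_meets_Ico _ _).compl.isOpen
  have hfin : finSets ⊆ U := fun z hz => by
    obtain ⟨M, hM⟩ := Set.Finite.bddAbove hz
    refine mem_iUnion.2 ⟨M + 1, fun ⟨p, hpz, hp⟩ => ?_⟩
    have h1 := hM hpz
    have h2 := hd.le_apply (x := M + 1)
    have h3 := hp.1
    omega
  refine (Cardinal.mk_le_mk_of_subset ?_).trans_lt (h.card_diff_lt U hU hfin)
  rintro x ⟨hxX, hx⟩
  refine ⟨Or.inl hxX, fun hxU => ?_⟩
  obtain ⟨i, hi⟩ := mem_iUnion.1 hxU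
  refine hi ⟨enum x (d i), enum_mem (hX hxX) _, (enum_strictMono (hX hxX)).le_apply, ?_⟩
  have h1 := hx (d i)
  have h2 := hcd i
  omega

/-- For fewer than `𝔟` many `x ∈ X` is `x(n)` below `f(n)` for almost all `n` in a given infinite
set: such an `x`, being increasing, is bounded by a function that depends on `f` and the given set
only, up to a finite error. -/
lemma card_finite_inter_lt {X : Set (Set ℕ)} (hX : X ⊆ infSets)
    (h : IsConcentratedOn cardB (X ∪ finSets) finSets) (f : ℕ → ℕ) {a : Set ℕ} (ha : a.Infinite) :
    #{x ∈ X | ({n | f n ≤ enum x n} ∩ a).Finite} < cardB := by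
  choose next hnext hlt using ha.exists_gt
  refine (Cardinal.mk_le_mk_of_subset ?_).trans_lt
    (card_iUnion_lt fun N => card_dominated_lt hX h fun n => f (next (max n N)))
  rintro x ⟨hxX, hx⟩
  obtain ⟨N, hN⟩ := hx.bddAbove
  refine mem_iUnion.2 ⟨N, hxX, fun n => ?_⟩
  have h1 := hlt (max n N)
  have h2 : enum x n ≤ enum x (next (max n N)) :=
    (enum_strictMono (hX hxX)).monotone ((le_max_left n N).trans h1.le)
  refine h2.trans (not_lt.1 fun hc => ?_)
  have h3 := hN ⟨hc.le, hnext _⟩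
  have := le_max_right n N
  omega

/-! ### The semifilter trichotomy -/

lemma finite_setQuot {x h : Set ℕ} (hh : h.Infinite) (hx : x.Finite) :
    (setQuot x h).Finite := by
  obtain ⟨M, hM⟩ := hx.bddAbove
  refine (finite_Iic M).subset fun n ⟨p, hpx, hp⟩ => ?_
  exact ((enum_strictMono hh).le_apply.trans hp.1).trans (hM hpx)

lemma almostSubset_setQuot {x y h : Set ℕ} (hh : h.Infinite) (hxy : AlmostSubset x y) :
    AlmostSubset (setQuot x h) (setQuot y h) := by
  refine (finite_setQuot hh hxy).subset ?_
  rintro n ⟨⟨p, hpx, hp⟩, hn⟩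
  exact ⟨p, ⟨hpx, fun hpy => hn ⟨p, hpy, hp⟩⟩, hp⟩

lemma infinite_setQuot {x h : Set ℕ} (hh : h.Infinite) (hx : x.Infinite) :
    (setQuot x h).Infinite := by
  intro hfin
  obtain ⟨M, hM⟩ := hfin.bddAbove
  obtain ⟨p, hpx, hp⟩ := hx.exists_gt (enum h (M + 1))
  obtain ⟨n, hn⟩ := exists_mem_Ico_of_strictMono (enum_strictMono hh)
    (((enum_strictMono hh).monotone (Nat.zero_le (M + 1))).trans hp.le)
  have h1 := hM ⟨p, hpx, hn⟩
  have h2 := (enum_strictMono hh).lt_iff_lt.1 (hp.trans hn.2)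
  omega

/-- A nonempty family such that, whenever an element is cut into two parts, one of them is again an
element. Both alternatives of the trichotomy other than `cFin` have this property. -/
def IsPartitionRegular (T : Set (Set ℕ)) : Prop :=
  T.Nonempty ∧ ∀ u ∈ T, ∀ a : Set ℕ, u ∩ a ∈ T ∨ u \ a ∈ T

lemma isPartitionRegular_infSets : IsPartitionRegular infSets := by
  refine ⟨⟨univ, infinite_univ⟩, fun u hu a => ?_⟩
  by_contra! hc
  exact hu (by simpa [inter_union_sdiff] using (not_infinite.1 hc.1).union (not_infinite.1 hc.2))

lemma IsFreeUltrafilter.isPartitionRegular {T : Set (Set ℕ)} (hT : IsFreeUltrafilter T) :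
    IsPartitionRegular T := by
  obtain ⟨U, -, rfl⟩ := hT
  refine ⟨⟨univ, univ_mem (f := (U : Filter ℕ))⟩, fun u hu a => ?_⟩
  rcases U.mem_or_compl_mem a with h | h
  · exact Or.inl (inter_mem (f := (U : Filter ℕ)) hu h)
  · exact Or.inr (inter_mem (f := (U : Filter ℕ)) hu h)

lemma exists_infinite_compl {T : Set (Set ℕ)} (hT : IsPartitionRegular T) :
    ∃ u ∈ T, uᶜ.Infinite := by
  obtain ⟨u, hu⟩ := hT.1
  have heven : {n : ℕ | Even n}.Infinite := infinite_of_forall_exists_gt fun m =>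
    ⟨2 * (m + 1), by simp, by omega⟩
  have hodd : {n : ℕ | Even n}ᶜ.Infinite := infinite_of_forall_exists_gt fun m =>
    ⟨2 * (m + 1) + 1, by simp, by omega⟩
  rcases hT.2 u hu {n | Even n} with h | h
  · exact ⟨_, h, hodd.mono (compl_subset_compl.2 inter_subset_right)⟩
  · exact ⟨_, h, heven.mono fun n hn hn' => hn'.2 hn⟩

/-- The sets `c x` generate a semifilter `S`, and by assumption fewer than `𝔟` many of them are
almost disjoint from a given infinite set. Then `S / h` is not partition regular. Otherwise, it
would have an element `u` with infinite complement. Only fewer than `𝔟` many of the sets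
`c x / h` are almost contained in `u`, since these are almost disjoint from the complement of `u`.
Hence a single set `a` splits all of them, so neither `u ∩ a` nor `u \ a` almost contains a set
`c x / h`, and so neither belongs to `S / h`. -/
lemma not_isPartitionRegular_familyQuot {X S : Set (Set ℕ)} {c : Set ℕ → Set ℕ} {h : Set ℕ}
    (hh : h.Infinite) (hcinf : ∀ x ∈ X, (c x).Infinite)
    (hgen : ∀ y ∈ S, ∃ x ∈ X, AlmostSubset (c x) y)
    (hsmall : ∀ a : Set ℕ, a.Infinite → #{x ∈ X | (c x ∩ a).Finite} < cardB) :
    ¬ IsPartitionRegular (familyQuot S h) := by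
  intro hT
  have hmono := enum_strictMono hh
  obtain ⟨u, huT, hu⟩ := exists_infinite_compl hT
  let Q : Set (Set ℕ) := {x ∈ X | AlmostSubset (setQuot (c x) h) u}
  let e : Set ℕ := ⋃ n ∈ uᶜ, Ico (enum h n) (enum h (n + 1))
  have he : e.Infinite := infinite_of_forall_exists_gt fun m => by
    obtain ⟨n, hn, hmn⟩ := hu.exists_gt m
    exact ⟨enum h n, mem_biUnion hn ⟨le_rfl, hmono n.lt_succ_self⟩, hmn.trans_le hmono.le_apply⟩
  have hQ : #Q < cardB := by
    refine (Cardinal.mk_le_mk_of_subset ?_).trans_lt (hsmall e he)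
    rintro x ⟨hxX, hx⟩
    refine ⟨hxX, (Set.Finite.biUnion hx fun n _ =>
      finite_Ico (enum h n) (enum h (n + 1))).subset ?_⟩
    rintro p ⟨hpx, hpe⟩
    obtain ⟨n, hn, hp⟩ := mem_iUnion₂.1 hpe
    exact mem_biUnion (⟨⟨p, hpx, hp⟩, hn⟩ : n ∈ setQuot (c x) h \ u) hp
  obtain ⟨a, ha⟩ := exists_splitting (Z := (fun x => setQuot (c x) h) '' Q)
    (Cardinal.mk_image_le.trans_lt hQ)
    (forall_mem_image.2 fun x hx => infinite_setQuot hh (hcinf x hx.1))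
  have key : ∀ s ∈ familyQuot S h, s ⊆ u →
      ∃ x ∈ Q, AlmostSubset (setQuot (c x) h) s := by
    rintro _ ⟨y, hy, rfl⟩ hsu
    obtain ⟨x, hx, hxy⟩ := hgen y hy
    have := almostSubset_setQuot hh hxy
    exact ⟨x, ⟨hx, this.subset (sdiff_subset_sdiff_right hsu)⟩, this⟩
  rcases hT.2 u huT a with hs | hs
  · obtain ⟨x, hx, hfin⟩ := key _ hs inter_subset_left
    exact (ha _ (mem_image_of_mem _ hx)).2
      (hfin.subset (sdiff_subset_sdiff_right inter_subset_right))
  · obtain ⟨x, hx, hfin⟩ := key _ hs sdiff_subset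
    exact (ha _ (mem_image_of_mem _ hx)).1
      (hfin.subset fun n hn => ⟨hn.1, fun hn' => hn'.2 hn.2⟩)

lemma IsConcentratedOn.isIntervalUnbounded (hST : SemifilterTrichotomy) {X : Set (Set ℕ)}
    (hX : X ⊆ infSets) (hc : IsConcentratedOn cardB (X ∪ finSets) finSets) :
    IsIntervalUnbounded X := by
  intro f
  let c : Set ℕ → Set ℕ := fun x => {n | f n ≤ enum x n}
  let A : Set (Set ℕ) := {x ∈ X | (c x).Finite}
  have hA : #A < cardB := by simpa using card_finite_inter_lt hX hc f infinite_univ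
  have hcinf : ∀ x ∈ X \ A, (c x).Infinite := fun x hx hfin => hx.2 ⟨hx.1, hfin⟩
  have hne : (X \ A).Nonempty := by
    by_contra hne
    refine (cardB_le_union_finSets_iff.1 hc.card_le).not_gt
      ((Cardinal.mk_le_mk_of_subset ?_).trans_lt hA)
    exact sdiff_eq_empty.1 (not_nonempty_iff_eq_empty.1 hne)
  let S : Set (Set ℕ) := {y | y.Infinite ∧ ∃ x ∈ X \ A, AlmostSubset (c x) y}
  have hcS : ∀ x ∈ X \ A, c x ∈ S := fun x hx => ⟨hcinf x hx, x, hx, by simp [AlmostSubset]⟩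
  have hS : IsSemifilter S :=
    { subset := fun y hy => hy.1
      nonempty := (hne.image c).mono (image_subset_iff.2 hcS)
      upward := fun y hy z hz hyz => by
        obtain ⟨-, x, hx, hxy⟩ := hy
        refine ⟨hz, x, hx, (Set.Finite.union hxy hyz).subset fun n hn => ?_⟩
        by_cases hny : n ∈ y
        · exact Or.inr ⟨hny, hn.2⟩
        · exact Or.inl ⟨hn.1, hny⟩ }
  obtain ⟨h, hh, hcase⟩ := hST S hS
  have hnot : ¬ IsPartitionRegular (familyQuot S h) :=
    not_isPartitionRegular_familyQuot hh hcinf (fun y hy => hy.2) fun a ha =>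
      (Cardinal.mk_le_mk_of_subset (fun x (hx : x ∈ {x ∈ X \ A | (c x ∩ a).Finite}) =>
        (⟨hx.1.1, hx.2⟩ : x ∈ {x ∈ X | (c x ∩ a).Finite}))).trans_lt
        (card_finite_inter_lt hX hc f ha)
  rcases hcase with hcof | hult | hinf
  · refine ⟨enum h, enum_strictMono hh, A, sep_subset _ _, hA, fun x hx => ?_⟩
    have hcx : setQuot (c x) h ∈ cofinSets := hcof ▸ mem_image_of_mem _ (hcS x hx)
    obtain ⟨M, hM⟩ := Set.Finite.bddAbove hcx
    filter_upwards [eventually_gt_atTop M] with n hn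
    by_contra hne'
    refine hn.not_ge (hM fun ⟨k, hk, hkn⟩ => hne' ⟨k, hkn, hk⟩)
  · exact absurd hult.isPartitionRegular hnot
  · exact absurd (hinf ▸ isPartitionRegular_infSets) hnot

/-! ### Products with Hurewicz sets of reals -/

/-- An increasing open cover of `E × Y` can be refined, uniformly in the points of `Y`, so that
covering depends only on a gap of the point in `E`. -/
lemma exists_gap_bound {E : Set (Set ℕ)} (hE : finSets ⊆ E) {β : Type} [TopologicalSpace β]
    (hβ : IsHurewicz β) {U : ℕ → ℕ → Set (↥E × β)} (hmono : ∀ n, Monotone (U n))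
    (hopen : ∀ n m, IsOpen (U n m)) (hcov : ∀ n p, ∃ m, p ∈ U n m) :
    ∃ g : ℕ → ℕ, Monotone g ∧ ∀ y, ∀ᶠ k in atTop, ∀ n ≤ k, ∀ z : ↥E,
      z.1 ∩ Ico k (g k) = ∅ → (z, y) ∈ U n (g k) := by
  let V : ℕ → ℕ → Set β := fun k l =>
    {y | ∀ᶠ y' in 𝓝 y, ∀ n ≤ k, ∀ z : ↥E, z.1 ∩ Ico k l = ∅ → (z, y') ∈ U n l}
  have hVmono : ∀ k, Monotone (V k) := fun k l l' hl y hy => by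
    filter_upwards [hy] with y' hy' n hn z hz
    exact hmono n hl (hy' n hn z (subset_eq_empty
      (inter_subset_inter_right _ (Ico_subset_Ico_right hl)) hz))
  have hVopen : ∀ k l, IsOpen (V k l) := fun k l => isOpen_setOfPred_eventually_nhds
  have hVcov : ∀ k y, ∃ l, y ∈ V k l := fun k y => by
    -- Finitely many points `(s, y)` with `s ⊆ [0, k)` have to be covered.
    have hev : ∀ᶠ p : ℕ × β in atTop ×ˢ 𝓝 y, ∀ s ∈ 𝒫 (Iio k), ∀ n ∈ Iic k, ∀ z : ↥E,
        (∀ i < p.1, (i ∈ z.1 ↔ i ∈ s)) → (z, p.2) ∈ U n p.1 := by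
      refine (eventually_all_finite (finite_Iio k).finite_subsets).2 fun s hs =>
        (eventually_all_finite (finite_Iic k)).2 fun n _ => ?_
      obtain ⟨m, hm⟩ := hcov n (⟨s, hE ((finite_Iio k).subset hs)⟩, y)
      obtain ⟨u, v, hu, hv, hsu, hyv, huv⟩ := isOpen_prod_iff.1 (hopen n m) _ _ hm
      obtain ⟨w, hw, rfl⟩ := isOpen_induced_iff.1 hu
      obtain ⟨l, hl⟩ := exists_cylinder_subset hw hsu
      filter_upwards [(eventually_ge_atTop (max l m)).prod_mk (hv.mem_nhds hyv)]
      rintro ⟨l', y'⟩ ⟨hl', hy'⟩ z hz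
      exact hmono n ((le_max_right l m).trans hl') (huv ⟨hl z.1 fun i hi =>
        hz i (hi.trans_le ((le_max_left l m).trans hl')), hy'⟩)
    obtain ⟨l, hl⟩ := hev.curry.exists
    refine ⟨l, hl.mono fun y' hy' n hn z hz =>
      hy' (z.1 ∩ Iio k) inter_subset_right n hn z fun i hi => ?_⟩
    refine ⟨fun hiz => ⟨hiz, ?_⟩, fun h => h.1⟩
    by_contra hik
    exact hz.subset ⟨hiz, not_lt.1 hik, hi⟩
  obtain ⟨g, hg⟩ := hβ.exists_bound hVmono hVopen hVcov
  refine ⟨partialSups g, (partialSups g).monotone, fun y => (hg y).mono fun k hk => ?_⟩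
  exact (hVmono k (le_partialSups g k) hk).self_of_nhds

/-- A large value `x(j)` forces a gap `[d(i), d(i+1))` of `x` with `n ≤ i ≤ 2j`: below
`d(2j+1) ≤ x(j)` there are at most `j` elements of `x`, too few for the `j+1` intervals with
`n ≤ i ≤ n+j`. -/
lemma exists_gap {x : Set ℕ} (hx : x.Infinite) {d : ℕ → ℕ} (hd : StrictMono d) {n j : ℕ}
    (hnj : n ≤ j) (hj : d (2 * j + 1) ≤ enum x j) :
    ∃ i, n ≤ i ∧ i ≤ 2 * j ∧ x ∩ Ico (d i) (d (i + 1)) = ∅ := by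
  by_contra! hc
  have := enum_lt_of_meets hx (d := d) (n := n) (j := j) fun i h1 h2 =>
    hc i h1 (by omega)
  exact (this.trans_le ((hd.monotone (by omega)).trans hj)).false

lemma IsIntervalUnbounded.isProductivelyHurewicz {X : Set (Set ℕ)} (hX : X ⊆ infSets)
    (h : IsIntervalUnbounded X) : IsProductivelyHurewicz ↥(X ∪ finSets) := by
  intro β _ hreal hβ
  obtain ⟨φ, hφ⟩ := hreal.embeds
  have : SecondCountableTopology β := hφ.secondCountableTopology
  refine isHurewicz_of_exists_bound fun U hmono hopen hcov => ?_
  obtain ⟨g, hgmono, hg⟩ := exists_gap_bound subset_union_right hβ hmono hopen hcov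
  obtain ⟨d, hd, hgd⟩ := exists_strictMono_le g
  obtain ⟨h, hh, A, hAX, hAc, hbig⟩ := h fun j => d (2 * j + 1)
  -- The fibers over the few exceptional points are treated one by one.
  have hfib : ∀ a : Set ℕ, ∃ f : ℕ → ℕ, ∀ ha : a ∈ A, ∀ y, ∀ᶠ n in atTop,
      ((⟨a, Or.inl (hAX ha)⟩ : ↥(X ∪ finSets)), y) ∈ U n (f n) := fun a => by
    by_cases ha : a ∈ A
    · obtain ⟨f, hf⟩ := hβ.exists_bound
        (U := fun n m => (fun y => ((⟨a, Or.inl (hAX ha)⟩ : ↥(X ∪ finSets)), y)) ⁻¹' U n m)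
        (fun n _ _ hm => preimage_mono (hmono n hm))
        (fun n m => (hopen n m).preimage (by fun_prop)) (fun n y => hcov n _)
      exact ⟨f, fun _ => hf⟩
    · exact ⟨0, fun h => absurd h ha⟩
  choose f hf using hfib
  obtain ⟨f', hf'⟩ := exists_bound_of_card_lt hAc f
  -- If `j < h(n+1)` and `i ≤ 2j`, then `g(d(i))` is at most the last of these values.
  refine ⟨fun n => max (f' n) (max (g n) (g (d (2 * h (n + 1))))), ?_⟩
  rintro ⟨⟨x, hx⟩, y⟩
  by_cases hxA : x ∈ A
  · filter_upwards [hf x hxA y, hf' x hxA] with n h1 h2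
    exact hmono n (h2.trans (le_max_left _ _)) h1
  by_cases hxfin : x.Finite
  · obtain ⟨M, hM⟩ := hxfin.bddAbove
    filter_upwards [hg y, eventually_gt_atTop M] with n h1 h2
    refine hmono n ((le_max_left _ _).trans (le_max_right _ _))
      (h1 n le_rfl ⟨x, hx⟩ (eq_empty_of_forall_notMem fun p ⟨hpx, hp⟩ => ?_))
    exact absurd (hM hpx) (not_le.2 (h2.trans_le hp.1))
  · have hxX : x ∈ X := hx.resolve_right hxfin
    obtain ⟨K, hK⟩ := eventually_atTop.1 (hg y)
    filter_upwards [hbig x ⟨hxX, hxA⟩, eventually_ge_atTop K] with n hn hKn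
    obtain ⟨j, hj, hxj⟩ := hn
    have hnj : n ≤ j := hh.le_apply.trans hj.1
    obtain ⟨i, hni, hij, hgap⟩ := exists_gap (hX hxX) hd hnj hxj
    have hidi : i ≤ d i := hd.le_apply
    have hmem := hK (d i) (by omega) n (by omega) ⟨x, hx⟩ (subset_eq_empty
      (inter_subset_inter_right _ (Ico_subset_Ico_right (hgd i))) hgap)
    refine hmono n ?_ hmem
    have h1 : i ≤ 2 * h (n + 1) := by
      have := hj.2
      omega
    exact (hgmono (hd.monotone h1)).trans ((le_max_right _ _).trans (le_max_right _ _))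

end SemHur

theorem mainTheorem2 (hST : SemHur.SemifilterTrichotomy) (X : Set (Set ℕ))
    (hX : X ⊆ SemHur.infSets) :
    List.TFAE [
      SemHur.IsConcentratedOn SemHur.cardB (X ∪ SemHur.finSets) SemHur.finSets,
      SemHur.IsConcentratedOn SemHur.cardB (X ∪ SemHur.finSets) SemHur.finSets ∧
        SemHur.IsHurewicz ↥(X ∪ SemHur.finSets),
      SemHur.IsConcentratedOn SemHur.cardB (X ∪ SemHur.finSets) SemHur.finSets ∧
        SemHur.IsProductivelyHurewicz ↥(X ∪ SemHur.finSets),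
      SemHur.IsMeagerUnbounded X] := by
  tfae_have 3 → 2 := fun h => ⟨h.1, h.2.isHurewicz⟩
  tfae_have 2 → 1 := fun h => h.1
  tfae_have 1 → 3 := fun h => ⟨h, (h.isIntervalUnbounded hST hX).isProductivelyHurewicz hX⟩
  tfae_have 1 → 4 := fun h => (h.isIntervalUnbounded hST hX).isMeagerUnbounded
    (SemHur.cardB_le_union_finSets_iff.1 h.card_le)
  tfae_have 4 → 1 := fun h => h.isConcentratedOn
  tfae_finish
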